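/- Let $(\tilde L,\Phi,\xi,\eta,g)$ be a smooth almost contact metric manifold, i.e. $\Phi^2=-I+\eta\otimes\xi$, $\eta(\xi)=1$, $\Phi\xi=0$, $\eta\circ\Phi=0$ and $g(\Phi X,\Phi Y)=g(X,Y)-\eta(X)\eta(Y)$. Assume that it is locally conformal almost cosymplectic: for some smooth function $\beta$ on $\tilde L$ and the Levi-Civita connection $\tilde\nabla$ of $g$, $$(\tilde\nabla_X\Phi)Y=\beta\big(g(\Phi X,Y)\xi-\eta(Y)\Phi X\big),\qquad \tilde\nabla_X\xi=\beta\big(X-\eta(X)\xi\big)$$ for all vector fields $X,Y$. Let $L=L_\nu\times_{\phi_1}L_T\times_{\phi_2}L_\perp$ be a bi-warped product submanifold of $\tilde L$: here $(L_\nu,g_\nu)$, $(L_T,g_T)$, $(L_\perp,g_\perp)$ are non-empty Riemannian manifolds, $L_\nu$ is connected, $\phi_1,\phi_2:L_\nu\to(0,\infty)$ are smooth, and $L_\nu\times L_T\times L_\perp$ is smoothly immersed in $\tilde L$ with induced metric $g_\nu+\phi_1^2g_T+\phi_2^2g_\perp$. Denote by $\mathfrak D^\nu,\mathfrak D,\mathfrak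 D^\perp$ the distributions tangent to the leaves $L_\nu,L_T,L_\perp$. Assume that, for a constant $\nu\in(0,\pi/2)$, the leaves $L_\nu$ are slant with slant angle $\nu$ (the angle between $\Phi X$ and $\mathfrak D^\nu_x$ is $\nu$ for every $X\in\mathfrak D^\nu_x$ linearly independent of $\xi$), that the leaves $L_T$ are invariant ($\Phi\mathfrak D\subseteq\mathfrak D$), and that the leaves $L_\perp$ are anti-invariant ($\Phi\mathfrak D^\perp\perp\mathfrak D^\perp$). If $\xi$ is a section of $\mathfrak D$ or of $\mathfrak D^\perp$ along $L$, then the warping function of the corresponding factor is constant and $L$ is a single warped product: (i) if $\xi\in\Gamma(\mathfrak D)$, then $\phi_1$ is a constant $k>0$ and $L$ is the warped product $B\times_{\phi_2}L_\perp$ with base the Riemannian product $B=(L_\nu\times L_T,\;g_\nu+k^2g_T)$; (ii) if $\xi\in\Gamma(\mathfrak D^\perp)$, then $\phi_2$ is a constant $k>0$ and $L$ is the warped product $B\times_{\phi_1}L_T$ with base the Riemannian product $B=(L_\nu\times L_\perp,\;g_\nu+k^2g_\perp)$. -/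

import Mathlib

open Bundle
open scoped Manifold ContDiff

noncomputable section

section AlmostContact

variable {E : Type*} [NormedAddCommGroup E] [NormedSpace ℝ E]
  {M : Type*} [TopologicalSpace M] [ChartedSpace E M] [IsManifold 𝓘(ℝ, E) ∞ M]
  [RiemannianBundle (fun x : M ↦ TangentSpace 𝓘(ℝ, E) x)]

variable (E M) in
/-- An almost contact metric structure `(Φ, ξ, η, g)` on the Riemannian manifold `(M, g)`. The
metric `g` is the inner product on the tangent spaces of `M`. The form `η` is smooth because
`phi_metric` at `Y = ξ` forces `η = g(·, ξ)`, and the dimension of `M` is odd because `Φ` is an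
isometric complex structure on the orthogonal complement of `ξ`. -/
structure AlmostContactMetricStructure where
  /-- the endomorphism field `Φ` -/
  phi : ∀ x : M, TangentSpace 𝓘(ℝ, E) x →L[ℝ] TangentSpace 𝓘(ℝ, E) x
  /-- the structure (Reeb) vector field `ξ` -/
  xi : ∀ x : M, TangentSpace 𝓘(ℝ, E) x
  /-- the contact form `η` -/
  eta : ∀ x : M, TangentSpace 𝓘(ℝ, E) x →L[ℝ] ℝ
  phi_smooth : ContMDiff 𝓘(ℝ, E) (𝓘(ℝ, E).prod 𝓘(ℝ, E →L[ℝ] E)) ∞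
    (fun x ↦ TotalSpace.mk' (E →L[ℝ] E)
      (E := fun x : M ↦ TangentSpace 𝓘(ℝ, E) x →L[ℝ] TangentSpace 𝓘(ℝ, E) x) x (phi x))
  xi_smooth : ContMDiff 𝓘(ℝ, E) (𝓘(ℝ, E).prod 𝓘(ℝ, E)) ∞
    (fun x ↦ TotalSpace.mk' E (E := fun x : M ↦ TangentSpace 𝓘(ℝ, E) x) x (xi x))
  phi_phi : ∀ (x : M) (X : TangentSpace 𝓘(ℝ, E) x), phi x (phi x X) = -X + eta x X • xi x
  eta_xi : ∀ x : M, eta x (xi x) = 1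
  phi_xi : ∀ x : M, phi x (xi x) = 0
  eta_phi : ∀ (x : M) (X : TangentSpace 𝓘(ℝ, E) x), eta x (phi x X) = 0
  phi_metric : ∀ (x : M) (X Y : TangentSpace 𝓘(ℝ, E) x),
    inner ℝ (phi x X) (phi x Y) = inner ℝ X Y - eta x X * eta x Y

/-- A connection `D` on the tangent bundle is the Levi-Civita connection: it is compatible with the
metric, `X g(σ, τ) = g(∇_X σ, τ) + g(σ, ∇_X τ)` for differentiable vector fields `σ` and `τ`, and
has no torsion. -/
def IsLeviCivita [FiniteDimensional ℝ E]
    (D : CovariantDerivative 𝓘(ℝ, E) E (fun x : M ↦ TangentSpace 𝓘(ℝ, E) x)) : Prop :=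
  (∀ (σ τ : ∀ x : M, TangentSpace 𝓘(ℝ, E) x) (x : M) (X : TangentSpace 𝓘(ℝ, E) x),
    MDifferentiableAt 𝓘(ℝ, E) (𝓘(ℝ, E).prod 𝓘(ℝ, E))
      (fun y ↦ TotalSpace.mk' E (E := fun y : M ↦ TangentSpace 𝓘(ℝ, E) y) y (σ y)) x →
    MDifferentiableAt 𝓘(ℝ, E) (𝓘(ℝ, E).prod 𝓘(ℝ, E))
      (fun y ↦ TotalSpace.mk' E (E := fun y : M ↦ TangentSpace 𝓘(ℝ, E) y) y (τ y)) x →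
    (mfderiv 𝓘(ℝ, E) 𝓘(ℝ, ℝ) (fun y ↦ (inner ℝ (σ y) (τ y) : ℝ)) x X : ℝ) =
      inner ℝ (D σ x X) (τ x) + inner ℝ (σ x) (D τ x X)) ∧
  D.torsion = 0

/-- The almost contact metric structure `S` is locally conformal almost cosymplectic: for the
Levi-Civita connection `∇` and some smooth function `β`,
`(∇_X Φ) Y = β (g(Φ X, Y) ξ - η(Y) Φ X)` and `∇_X ξ = β (X - η(X) ξ)`,
where `(∇_X Φ) Y = ∇_X (Φ Y) - Φ (∇_X Y)`. In Mathlib's argument order, `D Y x X` is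
`∇_X Y` at the point `x`. -/
def AlmostContactMetricStructure.IsLocallyConformalAlmostCosymplectic [FiniteDimensional ℝ E]
    (S : AlmostContactMetricStructure E M) : Prop :=
  ∃ (D : CovariantDerivative 𝓘(ℝ, E) E (fun x : M ↦ TangentSpace 𝓘(ℝ, E) x)) (β : M → ℝ),
    IsLeviCivita D ∧ ContMDiff 𝓘(ℝ, E) 𝓘(ℝ, ℝ) ∞ β ∧
    (∀ Y : ∀ x : M, TangentSpace 𝓘(ℝ, E) x,
      ContMDiff 𝓘(ℝ, E) (𝓘(ℝ, E).prod 𝓘(ℝ, E)) ∞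
        (fun x ↦ TotalSpace.mk' E (E := fun x : M ↦ TangentSpace 𝓘(ℝ, E) x) x (Y x)) →
      ∀ (x : M) (X : TangentSpace 𝓘(ℝ, E) x),
        D (fun y ↦ S.phi y (Y y)) x X - S.phi x (D Y x X) =
          β x • ((inner ℝ (S.phi x X) (Y x)) • S.xi x - S.eta x (Y x) • S.phi x X)) ∧
    ∀ (x : M) (X : TangentSpace 𝓘(ℝ, E) x), D S.xi x X = β x • (X - S.eta x X • S.xi x)

end AlmostContact

section Submanifold

variable {E : Type*} [NormedAddCommGroup E] [NormedSpace ℝ E]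
  {M : Type*} [TopologicalSpace M] [ChartedSpace E M] [IsManifold 𝓘(ℝ, E) ∞ M]
  [RiemannianBundle (fun x : M ↦ TangentSpace 𝓘(ℝ, E) x)]
  {F : Type*} [NormedAddCommGroup F] [NormedSpace ℝ F]
  {N : Type*} [TopologicalSpace N] [ChartedSpace F N]

/-- The tangent space at `f x` of the (immersed) submanifold `f : N → M`. -/
def tangentImage (E F : Type*) [NormedAddCommGroup E] [NormedSpace ℝ E]
    [NormedAddCommGroup F] [NormedSpace ℝ F]
    {M : Type*} [TopologicalSpace M] [ChartedSpace E M]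
    {N : Type*} [TopologicalSpace N] [ChartedSpace F N] (f : N → M) (x : N) :
    Submodule ℝ (TangentSpace 𝓘(ℝ, E) (f x)) :=
  LinearMap.range (mfderiv 𝓘(ℝ, F) 𝓘(ℝ, E) f x).toLinearMap

/-- The angle between the vector `v` and the subspace `W` is `θ`: it is the angle between `v` and
its orthogonal projection `w` to `W` (which is `π / 2` if `w = 0`). -/
def HasAngleWith {V : Type*} [NormedAddCommGroup V] [InnerProductSpace ℝ V]
    (v : V) (W : Submodule ℝ V) (θ : ℝ) : Prop :=
  ∃ w ∈ W, (∀ u ∈ W, inner ℝ (v - w) u = 0) ∧ InnerProductGeometry.angle v w = θ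

variable (F) in
/-- The submanifold `f : N → M` is invariant: `Φ` maps its tangent spaces to themselves. -/
def AlmostContactMetricStructure.IsInvariant (S : AlmostContactMetricStructure E M)
    (f : N → M) : Prop :=
  ∀ x : N, ∀ X ∈ tangentImage E F f x, S.phi (f x) X ∈ tangentImage E F f x

variable (F) in
/-- The submanifold `f : N → M` is anti-invariant: `Φ` maps its tangent spaces to its normal
spaces. -/
def AlmostContactMetricStructure.IsAntiInvariant (S : AlmostContactMetricStructure E M)
    (f : N → M) : Prop :=
  ∀ x : N, ∀ X ∈ tangentImage E F f x, ∀ Y ∈ tangentImage E F f x,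
    inner ℝ (S.phi (f x) X) Y = 0

variable (F) in
/-- The submanifold `f : N → M` is slant with slant angle `ν`: for all tangent vectors `X` that
are linearly independent of `ξ`, the angle between `Φ X` and the tangent space is `ν`. -/
def AlmostContactMetricStructure.IsSlant (S : AlmostContactMetricStructure E M) (ν : ℝ)
    (f : N → M) : Prop :=
  ∀ x : N, ∀ X ∈ tangentImage E F f x, LinearIndependent ℝ ![X, S.xi (f x)] →
    HasAngleWith (S.phi (f x) X) (tangentImage E F f x) ν

end Submanifold

section Warped

variable {E : Type*} [NormedAddCommGroup E] [NormedSpace ℝ E]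
  {M : Type*} [TopologicalSpace M] [ChartedSpace E M]
  [RiemannianBundle (fun x : M ↦ TangentSpace 𝓘(ℝ, E) x)]
  {E₁ : Type*} [NormedAddCommGroup E₁] [NormedSpace ℝ E₁]
  {N₁ : Type*} [TopologicalSpace N₁] [ChartedSpace E₁ N₁]
  [RiemannianBundle (fun x : N₁ ↦ TangentSpace 𝓘(ℝ, E₁) x)]
  {E₂ : Type*} [NormedAddCommGroup E₂] [NormedSpace ℝ E₂]
  {N₂ : Type*} [TopologicalSpace N₂] [ChartedSpace E₂ N₂]
  [RiemannianBundle (fun x : N₂ ↦ TangentSpace 𝓘(ℝ, E₂) x)]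
  {E₃ : Type*} [NormedAddCommGroup E₃] [NormedSpace ℝ E₃]
  {N₃ : Type*} [TopologicalSpace N₃] [ChartedSpace E₃ N₃]
  [RiemannianBundle (fun x : N₃ ↦ TangentSpace 𝓘(ℝ, E₃) x)]

variable (E E₁ E₂ E₃) in
/-- The smooth map `f : N₁ × N₂ × N₃ → M` exhibits the bi-warped product
`N₁ ×_{φ₂} N₂ ×_{φ₃} N₃` as a submanifold of `M`: `φ₂` and `φ₃` are positive smooth functions
on `N₁`, and the metric induced by `f` is
`g(π₁_* v, π₁_* w) + (φ₂ ∘ π₁)² g(π₂_* v, π₂_* w) + (φ₃ ∘ π₁)² g(π₃_* v, π₃_* w)`.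
This metric is positive definite, so `f` is an immersion. -/
structure IsBiWarpedProductSubmanifold (φ₂ φ₃ : N₁ → ℝ) (f : N₁ × N₂ × N₃ → M) : Prop where
  pos₂ : ∀ a, 0 < φ₂ a
  pos₃ : ∀ a, 0 < φ₃ a
  smooth₂ : ContMDiff 𝓘(ℝ, E₁) 𝓘(ℝ, ℝ) ∞ φ₂
  smooth₃ : ContMDiff 𝓘(ℝ, E₁) 𝓘(ℝ, ℝ) ∞ φ₃
  smooth : ContMDiff (𝓘(ℝ, E₁).prod (𝓘(ℝ, E₂).prod 𝓘(ℝ, E₃))) 𝓘(ℝ, E) ∞ f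
  metric : ∀ (p : N₁ × N₂ × N₃)
    (v w : TangentSpace (𝓘(ℝ, E₁).prod (𝓘(ℝ, E₂).prod 𝓘(ℝ, E₃))) p),
    inner ℝ (mfderiv (𝓘(ℝ, E₁).prod (𝓘(ℝ, E₂).prod 𝓘(ℝ, E₃))) 𝓘(ℝ, E) f p v)
      (mfderiv (𝓘(ℝ, E₁).prod (𝓘(ℝ, E₂).prod 𝓘(ℝ, E₃))) 𝓘(ℝ, E) f p w) =
    inner ℝ
      (mfderiv (𝓘(ℝ, E₁).prod (𝓘(ℝ, E₂).prod 𝓘(ℝ, E₃))) 𝓘(ℝ, E₁)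
        (fun q : N₁ × N₂ × N₃ ↦ q.1) p v)
      (mfderiv (𝓘(ℝ, E₁).prod (𝓘(ℝ, E₂).prod 𝓘(ℝ, E₃))) 𝓘(ℝ, E₁)
        (fun q : N₁ × N₂ × N₃ ↦ q.1) p w) +
    φ₂ p.1 ^ 2 * inner ℝ
      (mfderiv (𝓘(ℝ, E₁).prod (𝓘(ℝ, E₂).prod 𝓘(ℝ, E₃))) 𝓘(ℝ, E₂)
        (fun q : N₁ × N₂ × N₃ ↦ q.2.1) p v)
      (mfderiv (𝓘(ℝ, E₁).prod (𝓘(ℝ, E₂).prod 𝓘(ℝ, E₃))) 𝓘(ℝ, E₂)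
        (fun q : N₁ × N₂ × N₃ ↦ q.2.1) p w) +
    φ₃ p.1 ^ 2 * inner ℝ
      (mfderiv (𝓘(ℝ, E₁).prod (𝓘(ℝ, E₂).prod 𝓘(ℝ, E₃))) 𝓘(ℝ, E₃)
        (fun q : N₁ × N₂ × N₃ ↦ q.2.2) p v)
      (mfderiv (𝓘(ℝ, E₁).prod (𝓘(ℝ, E₂).prod 𝓘(ℝ, E₃))) 𝓘(ℝ, E₃)
        (fun q : N₁ × N₂ × N₃ ↦ q.2.2) p w)

variable (E₁ E₂) in
/-- The Riemannian product metric `g₁ + c² g₂` on `N₁ × N₂` (for a constant `c ≠ 0`), that is the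
product of `(N₁, g₁)` and of `N₂` with the rescaled metric `c² g₂`. -/
def productMetric (c : ℝ) (p : N₁ × N₂)
    (v w : TangentSpace (𝓘(ℝ, E₁).prod 𝓘(ℝ, E₂)) p) : ℝ :=
  inner ℝ
    (mfderiv (𝓘(ℝ, E₁).prod 𝓘(ℝ, E₂)) 𝓘(ℝ, E₁) (fun q : N₁ × N₂ ↦ q.1) p v)
    (mfderiv (𝓘(ℝ, E₁).prod 𝓘(ℝ, E₂)) 𝓘(ℝ, E₁) (fun q : N₁ × N₂ ↦ q.1) p w) +
  c ^ 2 * inner ℝ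
    (mfderiv (𝓘(ℝ, E₁).prod 𝓘(ℝ, E₂)) 𝓘(ℝ, E₂) (fun q : N₁ × N₂ ↦ q.2) p v)
    (mfderiv (𝓘(ℝ, E₁).prod 𝓘(ℝ, E₂)) 𝓘(ℝ, E₂) (fun q : N₁ × N₂ ↦ q.2) p w)

variable (E E₁ E₂ E₃) in
/-- The smooth map `f : (N₁ × N₂) × N₃ → M` exhibits the (single) warped product `B ×_φ N₃` as a
submanifold of `M`, where the base `B` is `N₁ × N₂` with the product metric `g₁ + c² g₂`: `c > 0`,
`φ` is a positive smooth function on `B`, and the metric induced by `f` is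
`g_B(π₁_* v, π₁_* w) + (φ ∘ π₁)² g(π₂_* v, π₂_* w)`. -/
structure IsWarpedProductSubmanifold (c : ℝ) (φ : N₁ × N₂ → ℝ)
    (f : (N₁ × N₂) × N₃ → M) : Prop where
  pos_c : 0 < c
  pos : ∀ b, 0 < φ b
  smooth_warping : ContMDiff (𝓘(ℝ, E₁).prod 𝓘(ℝ, E₂)) 𝓘(ℝ, ℝ) ∞ φ
  smooth : ContMDiff ((𝓘(ℝ, E₁).prod 𝓘(ℝ, E₂)).prod 𝓘(ℝ, E₃)) 𝓘(ℝ, E) ∞ f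
  metric : ∀ (p : (N₁ × N₂) × N₃)
    (v w : TangentSpace ((𝓘(ℝ, E₁).prod 𝓘(ℝ, E₂)).prod 𝓘(ℝ, E₃)) p),
    inner ℝ (mfderiv ((𝓘(ℝ, E₁).prod 𝓘(ℝ, E₂)).prod 𝓘(ℝ, E₃)) 𝓘(ℝ, E) f p v)
      (mfderiv ((𝓘(ℝ, E₁).prod 𝓘(ℝ, E₂)).prod 𝓘(ℝ, E₃)) 𝓘(ℝ, E) f p w) =
    productMetric E₁ E₂ c p.1
      (mfderiv ((𝓘(ℝ, E₁).prod 𝓘(ℝ, E₂)).prod 𝓘(ℝ, E₃)) (𝓘(ℝ, E₁).prod 𝓘(ℝ, E₂))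
        (fun q : (N₁ × N₂) × N₃ ↦ q.1) p v)
      (mfderiv ((𝓘(ℝ, E₁).prod 𝓘(ℝ, E₂)).prod 𝓘(ℝ, E₃)) (𝓘(ℝ, E₁).prod 𝓘(ℝ, E₂))
        (fun q : (N₁ × N₂) × N₃ ↦ q.1) p w) +
    φ p.1 ^ 2 * inner ℝ
      (mfderiv ((𝓘(ℝ, E₁).prod 𝓘(ℝ, E₂)).prod 𝓘(ℝ, E₃)) 𝓘(ℝ, E₃)
        (fun q : (N₁ × N₂) × N₃ ↦ q.2) p v)
      (mfderiv ((𝓘(ℝ, E₁).prod 𝓘(ℝ, E₂)).prod 𝓘(ℝ, E₃)) 𝓘(ℝ, E₃)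
        (fun q : (N₁ × N₂) × N₃ ↦ q.2) p w)

end Warped

end

/-! ### Local potentials of vector fields with symmetric covariant derivative. -/

section LocalPotential

open VectorField Filter Topology

variable {E : Type*} [NormedAddCommGroup E] [NormedSpace ℝ E] [FiniteDimensional ℝ E]
  {M : Type*} [TopologicalSpace M] [ChartedSpace E M] [IsManifold 𝓘(ℝ, E) ∞ M]

/-! The formula for `∇ξ` says that `∇ξ` is a symmetric endomorphism, so `η = g(·, ξ)` is closed and
locally `η = du` (`IsLeviCivita.exists_local_potential`). Let `G : N₁ × N₂ → M` be a warped product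
submanifold whose fibres `{a} × N₂` are tangent to `ξ`. Base directions are orthogonal to `ξ`, so `u
∘ G` locally does not depend on the base point `a`, and neither does its differential along the
fibre.

Write `ξ` at `G (a, b₀)` as the image of `(0, w)`. That differential is `φ(a)² g₂(w, ·)`, and `|ξ| =
1` gives `φ(a)² g₂(w, w) = 1`. The 1-form is the same for all nearby `a`, so its norm with respect
to the fixed metric `g₂`, namely `φ(a)`, is the same too. Thus `φ` is locally constant, hence
constant on the connected base (`exists_warping_eq_const`).

Freezing a point of the third factor of the bi-warped product leaves such a warped product, and
regrouping the factors then gives the single warped product metric. No second fundamental form or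
connection of the submanifold enters. -/

/-- The vector field with constant coefficients `v` in the chart at `x₀`. -/
noncomputable def coordField (x₀ : M) (v : E) : ∀ x : M, TangentSpace 𝓘(ℝ, E) x :=
  mpullback 𝓘(ℝ, E) 𝓘(ℝ, E) (extChartAt 𝓘(ℝ, E) x₀) (fun _ ↦ v)

lemma mdifferentiableAt_const_field (v z : E) :
    MDifferentiableAt 𝓘(ℝ, E) (𝓘(ℝ, E).prod 𝓘(ℝ, E))
      (fun y ↦ TotalSpace.mk' E (E := fun y : E ↦ TangentSpace 𝓘(ℝ, E) y) y v) z := by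
  have h : ContMDiffAt 𝓘(ℝ, E) (𝓘(ℝ, E).prod 𝓘(ℝ, E)) 1
      (fun y ↦ TotalSpace.mk' E (E := fun y : E ↦ TangentSpace 𝓘(ℝ, E) y) y v) z :=
    contMDiffAt_vectorSpace_iff_contDiffAt.2 contDiffAt_const
  exact h.mdifferentiableAt one_ne_zero

lemma mdifferentiableAt_coordField {x₀ x : M} (hx : x ∈ (extChartAt 𝓘(ℝ, E) x₀).source) (v : E) :
    MDifferentiableAt 𝓘(ℝ, E) (𝓘(ℝ, E).prod 𝓘(ℝ, E))
      (fun y ↦ TotalSpace.mk' E (E := fun y : M ↦ TangentSpace 𝓘(ℝ, E) y) y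
        (coordField x₀ v y)) x :=
  (mdifferentiableAt_const_field v _).mpullback_vectorField
    (contMDiffAt_extChartAt' (n := 2) (by simpa using hx))
    (isInvertible_mfderiv_extChartAt hx) le_rfl

/-- Brackets are natural under pullback by the chart, and constant fields on `E` commute. -/
lemma mlieBracket_coordField {x₀ x : M} (hx : x ∈ (extChartAt 𝓘(ℝ, E) x₀).source) (v w : E) :
    mlieBracket 𝓘(ℝ, E) (coordField x₀ v) (coordField x₀ w) x = 0 := by
  have : IsManifold 𝓘(ℝ, E) (minSmoothness ℝ 2) M := by
    simpa using! inferInstanceAs (IsManifold 𝓘(ℝ, E) 2 M)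
  have : IsManifold 𝓘(ℝ, E) (minSmoothness ℝ 2) E := by
    simpa using! inferInstanceAs (IsManifold 𝓘(ℝ, E) 2 E)
  have h := mpullback_mlieBracket (I := 𝓘(ℝ, E)) (I' := 𝓘(ℝ, E)) (n := 2)
    (mdifferentiableAt_const_field v (extChartAt 𝓘(ℝ, E) x₀ x))
    (mdifferentiableAt_const_field w (extChartAt 𝓘(ℝ, E) x₀ x))
    (contMDiffAt_extChartAt' (n := 2) (by simpa using hx)) (by simp)
  refine h.symm.trans ?_
  have h0 : mlieBracket 𝓘(ℝ, E) (fun y : E ↦ (v : TangentSpace 𝓘(ℝ, E) y))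
      (fun y : E ↦ (w : TangentSpace 𝓘(ℝ, E) y)) = 0 := by
    have h1 : lieBracketWithin ℝ (fun _ : E ↦ v) (fun _ ↦ w) Set.univ = 0 := by
      ext z
      simp [lieBracketWithin]
    exact mlieBracketWithin_univ.symm.trans (mlieBracketWithin_eq_lieBracketWithin.trans h1)
  rw [h0, mpullback_zero]
  rfl

/-- The inverse of an extended chart has the inverse derivative. -/
lemma hasMFDerivAt_extChartAt_symm {x₀ : M} {z : E} (hz : z ∈ (extChartAt 𝓘(ℝ, E) x₀).target) :
    HasMFDerivAt 𝓘(ℝ, E) 𝓘(ℝ, E) (extChartAt 𝓘(ℝ, E) x₀).symm z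
      (mfderiv 𝓘(ℝ, E) 𝓘(ℝ, E) (extChartAt 𝓘(ℝ, E) x₀)
        ((extChartAt 𝓘(ℝ, E) x₀).symm z)).inverse := by
  have hd : MDifferentiableAt 𝓘(ℝ, E) 𝓘(ℝ, E) (extChartAt 𝓘(ℝ, E) x₀).symm z := by
    have := mdifferentiableWithinAt_extChartAt_symm (I := 𝓘(ℝ, E)) hz
    rwa [ModelWithCorners.range_eq_univ, mdifferentiableWithinAt_univ] at this
  have h1 := mfderiv_extChartAt_comp_mfderivWithin_extChartAt_symm (I := 𝓘(ℝ, E)) hz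
  have h2 := mfderivWithin_extChartAt_symm_comp_mfderiv_extChartAt (I := 𝓘(ℝ, E)) hz
  rw [ModelWithCorners.range_eq_univ, mfderivWithin_univ] at h1 h2
  exact hd.hasMFDerivAt.congr_mfderiv (ContinuousLinearMap.inverse_eq h1 h2).symm

/-- In finite dimension a covector is determined linearly by its finitely many values on a basis. -/
lemma differentiableAt_of_forall_clm_apply {f : E → E →L[ℝ] ℝ} {z : E}
    (h : ∀ v, DifferentiableAt ℝ (fun z ↦ f z v) z) : DifferentiableAt ℝ f z := by
  let e₁ : E ≃L[ℝ] Fin (Module.finrank ℝ E) → ℝ :=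
    ContinuousLinearEquiv.ofFinrankEq (by simp)
  let e₂ := (e₁.arrowCongr (1 : ℝ ≃L[ℝ] ℝ)).trans
    (ContinuousLinearEquiv.piRing (Fin (Module.finrank ℝ E)))
  rw [← e₂.comp_differentiableAt_iff]
  exact differentiableAt_pi.2 fun i ↦ h _

variable [RiemannianBundle (fun x : M ↦ TangentSpace 𝓘(ℝ, E) x)]
  [IsContMDiffRiemannianBundle 𝓘(ℝ, E) ∞ E (fun x : M ↦ TangentSpace 𝓘(ℝ, E) x)]

lemma mdifferentiableAt_inner_field {V W : ∀ x : M, TangentSpace 𝓘(ℝ, E) x} {x : M}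
    (hV : MDifferentiableAt 𝓘(ℝ, E) (𝓘(ℝ, E).prod 𝓘(ℝ, E))
      (fun y ↦ TotalSpace.mk' E (E := fun y : M ↦ TangentSpace 𝓘(ℝ, E) y) y (V y)) x)
    (hW : MDifferentiableAt 𝓘(ℝ, E) (𝓘(ℝ, E).prod 𝓘(ℝ, E))
      (fun y ↦ TotalSpace.mk' E (E := fun y : M ↦ TangentSpace 𝓘(ℝ, E) y) y (W y)) x) :
    MDifferentiableAt 𝓘(ℝ, E) 𝓘(ℝ, ℝ) (fun y ↦ (inner ℝ (V y) (W y) : ℝ)) x := by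
  have : IsContMDiffRiemannianBundle 𝓘(ℝ, E) 1 E (fun x : M ↦ TangentSpace 𝓘(ℝ, E) x) :=
    .of_le (n := ∞) (by simp)
  exact MDifferentiableAt.inner_bundle (E := fun x : M ↦ TangentSpace 𝓘(ℝ, E) x) hV hW

/-- A vector field whose covariant derivative is a symmetric endomorphism field is locally a
gradient. -/
theorem IsLeviCivita.exists_local_potential
    {D : CovariantDerivative 𝓘(ℝ, E) E (fun x : M ↦ TangentSpace 𝓘(ℝ, E) x)}
    (hD : IsLeviCivita D) {V : ∀ x : M, TangentSpace 𝓘(ℝ, E) x}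
    (hV : MDifferentiable 𝓘(ℝ, E) (𝓘(ℝ, E).prod 𝓘(ℝ, E))
      (fun y ↦ TotalSpace.mk' E (E := fun y : M ↦ TangentSpace 𝓘(ℝ, E) y) y (V y)))
    (hsymm : ∀ (x : M) (X Y : TangentSpace 𝓘(ℝ, E) x),
      (inner ℝ (D V x X) Y : ℝ) = inner ℝ (D V x Y) X) (x₀ : M) :
    ∃ u : M → ℝ, ∀ᶠ x in 𝓝 x₀,
      HasMFDerivAt 𝓘(ℝ, E) 𝓘(ℝ, ℝ) u x (innerSL ℝ (V x) : TangentSpace 𝓘(ℝ, E) x →L[ℝ] ℝ) := by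
  set e := extChartAt 𝓘(ℝ, E) x₀ with he
  obtain ⟨r, hr, hrT⟩ := Metric.isOpen_iff.1 (isOpen_extChartAt_target (I := 𝓘(ℝ, E)) x₀) (e x₀)
    (mem_extChartAt_target x₀)
  -- The 1-form `g(V, ·)` read in the chart; its coefficients are the functions `g(V, coordField x₀
  -- v)`.
  let α : E → E →L[ℝ] ℝ := fun z ↦ (innerSL ℝ (V (e.symm z)) : _ →L[ℝ] ℝ).comp
    (mfderiv 𝓘(ℝ, E) 𝓘(ℝ, E) e (e.symm z)).inverse
  have hderiv : ∀ z ∈ e.target, ∀ v : E, HasFDerivAt (fun z ↦ α z v)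
      ((mfderiv 𝓘(ℝ, E) 𝓘(ℝ, ℝ) (fun y ↦ (inner ℝ (V y) (coordField x₀ v y) : ℝ)) (e.symm z)).comp
        (mfderiv 𝓘(ℝ, E) 𝓘(ℝ, E) e (e.symm z)).inverse) z := by
    intro z hz v
    have hx := e.map_target hz
    exact (((mdifferentiableAt_inner_field (hV _)
      (mdifferentiableAt_coordField hx v)).hasMFDerivAt.comp z
      (hasMFDerivAt_extChartAt_symm hz))).hasFDerivAt
  have hball : ∀ z ∈ e.target, DifferentiableAt ℝ α z := fun z hz ↦
    differentiableAt_of_forall_clm_apply fun v ↦ (hderiv z hz v).differentiableAt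
  -- Metric compatibility splits each derivative into two terms. The terms in `∇V` agree by `hsymm`;
  -- the terms in the covariant derivatives of coordinate fields agree because the torsion vanishes
  -- and these fields commute.
  have hclosed : ∀ z ∈ e.target, ∀ v w, fderiv ℝ α z v w = fderiv ℝ α z w v := by
    intro z hz v w
    have hx := e.map_target hz
    have key (v w : E) : fderiv ℝ α z w v =
        inner ℝ (D V (e.symm z) (coordField x₀ w (e.symm z))) (coordField x₀ v (e.symm z)) +
        inner ℝ (V (e.symm z)) (D (coordField x₀ v) (e.symm z) (coordField x₀ w (e.symm z))) := by
      have h1 : HasFDerivAt (fun z ↦ α z v) ((fderiv ℝ α z).flip v) z :=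
        (hball z hz).hasFDerivAt.clm_apply (hasFDerivAt_const v z) |>.congr_fderiv (by ext; simp)
      have h2 := congr($(h1.unique (hderiv z hz v)) w)
      exact h2.trans (hD.1 V (coordField x₀ v) (e.symm z) (coordField x₀ w (e.symm z)) (hV _)
        (mdifferentiableAt_coordField hx v))
    have htor := D.torsion_eq_zero_iff.1 hD.2 (mdifferentiableAt_coordField hx w)
      (mdifferentiableAt_coordField hx v)
    rw [mlieBracket_coordField hx, sub_eq_zero] at htor
    rw [key, key, hsymm, htor]
  -- Poincaré lemma for the closed form `α` on a ball in the chart.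
  obtain ⟨u, hu⟩ := (convex_ball (e x₀) r).exists_forall_hasFDerivAt_of_fderiv_symmetric
    Metric.isOpen_ball
    (fun z hz ↦ (hball z (hrT hz)).differentiableWithinAt) (fun z hz ↦ hclosed z (hrT hz))
  refine ⟨u ∘ e, ?_⟩
  have hnhds : e ⁻¹' Metric.ball (e x₀) r ∩ e.source ∈ 𝓝 x₀ :=
    inter_mem ((continuousAt_extChartAt x₀).preimage_mem_nhds (Metric.ball_mem_nhds _ hr))
      (extChartAt_source_mem_nhds x₀)
  filter_upwards [hnhds] with x hx
  have h1 : HasMFDerivAt 𝓘(ℝ, E) 𝓘(ℝ, E) e x (mfderiv 𝓘(ℝ, E) 𝓘(ℝ, E) e x) :=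
    (mdifferentiableAt_extChartAt (by simpa [e] using hx.2)).hasMFDerivAt
  have h2 := (hu _ hx.1).hasMFDerivAt.comp x h1
  have h3 : (α (e x)).comp (mfderiv 𝓘(ℝ, E) 𝓘(ℝ, E) e x) = innerSL ℝ (V x) := by
    -- The point `e.symm (e x)` is generalized to `y`, so that the equality with `x` can be
    -- substituted inside dependent types.
    have h4 : ∀ y, y = x → ∀ v : E, (inner ℝ (V y) ((mfderiv 𝓘(ℝ, E) 𝓘(ℝ, E) e y).inverse
        (mfderiv 𝓘(ℝ, E) 𝓘(ℝ, E) e x v)) : ℝ) = inner ℝ (V x) v := by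
      rintro _ rfl v
      exact congrArg (inner ℝ (V _)) ((isInvertible_mfderiv_extChartAt hx.2).inverse_apply_self v)
    ext v
    exact h4 _ (e.left_inv hx.2) v
  rw [← h3]
  exact h2

end LocalPotential

/-! ### The Reeb field is locally a gradient. -/

section ReebField

variable {E : Type*} [NormedAddCommGroup E] [NormedSpace ℝ E]
  {M : Type*} [TopologicalSpace M] [ChartedSpace E M] [IsManifold 𝓘(ℝ, E) ∞ M]
  [RiemannianBundle (fun x : M ↦ TangentSpace 𝓘(ℝ, E) x)]
  (S : AlmostContactMetricStructure E M)

namespace AlmostContactMetricStructure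

lemma eta_eq_inner (x : M) (X : TangentSpace 𝓘(ℝ, E) x) : S.eta x X = inner ℝ X (S.xi x) := by
  have h := S.phi_metric x X (S.xi x)
  rw [S.phi_xi, inner_zero_right, S.eta_xi] at h
  linarith

lemma inner_xi_xi (x : M) : (inner ℝ (S.xi x) (S.xi x) : ℝ) = 1 := by
  rw [← S.eta_eq_inner, S.eta_xi]

/-- On a locally conformal almost cosymplectic manifold the form `η` is closed, so that the
structure vector field is locally a gradient. -/
theorem IsLocallyConformalAlmostCosymplectic.exists_local_potential [FiniteDimensional ℝ E]
    [IsContMDiffRiemannianBundle 𝓘(ℝ, E) ∞ E (fun x : M ↦ TangentSpace 𝓘(ℝ, E) x)]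
    {S : AlmostContactMetricStructure E M} (hS : S.IsLocallyConformalAlmostCosymplectic) (x₀ : M) :
    ∃ u : M → ℝ, ∀ᶠ x in nhds x₀, HasMFDerivAt 𝓘(ℝ, E) 𝓘(ℝ, ℝ) u x
      (innerSL ℝ (S.xi x) : TangentSpace 𝓘(ℝ, E) x →L[ℝ] ℝ) := by
  obtain ⟨D, β, hD, -, -, hxi⟩ := hS
  refine hD.exists_local_potential (S.xi_smooth.mdifferentiable (by simp)) (fun x X Y ↦ ?_) x₀
  -- Both sides are `β (g(X, Y) - η(X) η(Y))`, which is symmetric in `X` and `Y`.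
  simp only [hxi, S.eta_eq_inner, real_inner_smul_left, inner_sub_left]
  rw [real_inner_comm X Y, real_inner_comm (S.xi x) X, real_inner_comm (S.xi x) Y]
  ring

end AlmostContactMetricStructure

end ReebField

/-! ### Constancy of the warping function when the Reeb field is tangent to the fibres. -/

section WarpingFunction

open Topology Filter

/-- Functions whose derivative vanishes on a neighbourhood of a point are constant on a smaller
neighbourhood, which does not depend on the function. -/
lemma exists_nhds_forall_eq_of_hasMFDerivAt_zero {F : Type*} [NormedAddCommGroup F]
    [NormedSpace ℝ F] {N : Type*} [TopologicalSpace N] [ChartedSpace F N]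
    [IsManifold 𝓘(ℝ, F) ∞ N] {a₀ : N} {s : Set N} (hs : s ∈ 𝓝 a₀) :
    ∃ t ∈ 𝓝 a₀, ∀ h : N → ℝ, (∀ a ∈ s, HasMFDerivAt 𝓘(ℝ, F) 𝓘(ℝ, ℝ) h a 0) →
      ∀ a ∈ t, h a = h a₀ := by
  set e := extChartAt 𝓘(ℝ, F) a₀ with he
  have hT : e.target ∩ e.symm ⁻¹' s ∈ 𝓝 (e a₀) :=
    inter_mem (extChartAt_target_mem_nhds a₀)
      ((continuousAt_extChartAt_symm a₀).preimage_mem_nhds (by rwa [extChartAt_to_inv]))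
  obtain ⟨r, hr, hrT⟩ := Metric.mem_nhds_iff.1 hT
  refine ⟨e ⁻¹' Metric.ball (e a₀) r ∩ e.source,
    inter_mem ((continuousAt_extChartAt a₀).preimage_mem_nhds (Metric.ball_mem_nhds _ hr))
      (extChartAt_source_mem_nhds a₀), fun h hh a ha ↦ ?_⟩
  have hd : ∀ z ∈ Metric.ball (e a₀) r, HasFDerivAt (h ∘ e.symm) (0 : F →L[ℝ] ℝ) z := by
    intro z hz
    have h1 : MDifferentiableAt 𝓘(ℝ, F) 𝓘(ℝ, F) e.symm z := by
      have := mdifferentiableWithinAt_extChartAt_symm (I := 𝓘(ℝ, F)) (hrT hz).1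
      rwa [ModelWithCorners.range_eq_univ, mdifferentiableWithinAt_univ] at this
    have h2 := (hh _ (hrT hz).2).comp z h1.hasMFDerivAt
    exact (h2.congr_mfderiv (ContinuousLinearMap.zero_comp _)).hasFDerivAt
  have hc := (convex_ball (e a₀) r).is_const_of_fderivWithin_eq_zero (𝕜 := ℝ) (f := h ∘ e.symm)
    (fun z hz ↦ (hd z hz).differentiableAt.differentiableWithinAt)
    (fun z hz ↦ (hd z hz).hasFDerivWithinAt.fderivWithin
      (Metric.isOpen_ball.uniqueDiffWithinAt hz)) ha.1 (Metric.mem_ball_self hr)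
  rwa [Function.comp_apply, Function.comp_apply, e.left_inv ha.2,
    e.left_inv (mem_extChartAt_source a₀)] at hc

variable {E : Type*} [NormedAddCommGroup E] [NormedSpace ℝ E] [FiniteDimensional ℝ E]
  {M : Type*} [TopologicalSpace M] [ChartedSpace E M] [IsManifold 𝓘(ℝ, E) ∞ M]
  [RiemannianBundle (fun x : M ↦ TangentSpace 𝓘(ℝ, E) x)]
  [IsContMDiffRiemannianBundle 𝓘(ℝ, E) ∞ E (fun x : M ↦ TangentSpace 𝓘(ℝ, E) x)]
  {E₁ : Type*} [NormedAddCommGroup E₁] [NormedSpace ℝ E₁]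
  {N₁ : Type*} [TopologicalSpace N₁] [ChartedSpace E₁ N₁] [IsManifold 𝓘(ℝ, E₁) ∞ N₁]
  [RiemannianBundle (fun x : N₁ ↦ TangentSpace 𝓘(ℝ, E₁) x)]
  {E₂ : Type*} [NormedAddCommGroup E₂] [NormedSpace ℝ E₂]
  {N₂ : Type*} [TopologicalSpace N₂] [ChartedSpace E₂ N₂] [IsManifold 𝓘(ℝ, E₂) ∞ N₂]
  [RiemannianBundle (fun x : N₂ ↦ TangentSpace 𝓘(ℝ, E₂) x)]

/-- If the structure vector field of a locally conformal almost cosymplectic manifold is tangent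
to the fibres of a warped product submanifold with connected base, then the warping function is
constant. -/
theorem AlmostContactMetricStructure.IsLocallyConformalAlmostCosymplectic.exists_warping_eq_const
    {S : AlmostContactMetricStructure E M} (hS : S.IsLocallyConformalAlmostCosymplectic)
    [ConnectedSpace N₁] [Nonempty N₂] {φ : N₁ → ℝ} (hφ : ∀ a, 0 < φ a) {G : N₁ × N₂ → M}
    (hG : MDifferentiable (𝓘(ℝ, E₁).prod 𝓘(ℝ, E₂)) 𝓘(ℝ, E) G)
    (hmetric : ∀ (p : N₁ × N₂) (v w : TangentSpace (𝓘(ℝ, E₁).prod 𝓘(ℝ, E₂)) p),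
      (inner ℝ (mfderiv (𝓘(ℝ, E₁).prod 𝓘(ℝ, E₂)) 𝓘(ℝ, E) G p v)
        (mfderiv (𝓘(ℝ, E₁).prod 𝓘(ℝ, E₂)) 𝓘(ℝ, E) G p w) : ℝ) =
      inner ℝ (mfderiv (𝓘(ℝ, E₁).prod 𝓘(ℝ, E₂)) 𝓘(ℝ, E₁) (fun q : N₁ × N₂ ↦ q.1) p v)
        (mfderiv (𝓘(ℝ, E₁).prod 𝓘(ℝ, E₂)) 𝓘(ℝ, E₁) (fun q : N₁ × N₂ ↦ q.1) p w) +
      φ p.1 ^ 2 *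
        inner ℝ (mfderiv (𝓘(ℝ, E₁).prod 𝓘(ℝ, E₂)) 𝓘(ℝ, E₂) (fun q : N₁ × N₂ ↦ q.2) p v)
          (mfderiv (𝓘(ℝ, E₁).prod 𝓘(ℝ, E₂)) 𝓘(ℝ, E₂) (fun q : N₁ × N₂ ↦ q.2) p w))
    (hxi : ∀ a b, S.xi (G (a, b)) ∈ tangentImage E E₂ (fun b : N₂ ↦ G (a, b)) b) :
    ∃ k : ℝ, ∀ a, φ a = k := by
  have hmetric' (a : N₁) (b : N₂) (v₁ w₁ : TangentSpace 𝓘(ℝ, E₁) a)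
      (v₂ w₂ : TangentSpace 𝓘(ℝ, E₂) b) :
      (inner ℝ (mfderiv (𝓘(ℝ, E₁).prod 𝓘(ℝ, E₂)) 𝓘(ℝ, E) G (a, b) (v₁, v₂))
        (mfderiv (𝓘(ℝ, E₁).prod 𝓘(ℝ, E₂)) 𝓘(ℝ, E) G (a, b) (w₁, w₂)) : ℝ) =
      inner ℝ v₁ w₁ + φ a ^ 2 * inner ℝ v₂ w₂ := by
    have h := hmetric (a, b) (v₁, v₂) (w₁, w₂)
    have h1 : mfderiv (𝓘(ℝ, E₁).prod 𝓘(ℝ, E₂)) 𝓘(ℝ, E₁) (fun q : N₁ × N₂ ↦ q.1) (a, b) =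
      ContinuousLinearMap.fst ℝ (TangentSpace 𝓘(ℝ, E₁) a) (TangentSpace 𝓘(ℝ, E₂) b) := mfderiv_fst
    have h2 : mfderiv (𝓘(ℝ, E₁).prod 𝓘(ℝ, E₂)) 𝓘(ℝ, E₂) (fun q : N₁ × N₂ ↦ q.2) (a, b) =
      ContinuousLinearMap.snd ℝ (TangentSpace 𝓘(ℝ, E₁) a) (TangentSpace 𝓘(ℝ, E₂) b) := mfderiv_snd
    rw [h1, h2] at h
    exact h
  have hleft (a : N₁) (b : N₂) : HasMFDerivAt 𝓘(ℝ, E₁) 𝓘(ℝ, E) (fun a ↦ G (a, b)) a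
      ((mfderiv (𝓘(ℝ, E₁).prod 𝓘(ℝ, E₂)) 𝓘(ℝ, E) G (a, b)).comp
        (ContinuousLinearMap.inl ℝ (TangentSpace 𝓘(ℝ, E₁) a) (TangentSpace 𝓘(ℝ, E₂) b))) :=
    (hG (a, b)).hasMFDerivAt.comp a ((hasMFDerivAt_id a).prodMk (hasMFDerivAt_const b a))
  have hright (a : N₁) (b : N₂) : HasMFDerivAt 𝓘(ℝ, E₂) 𝓘(ℝ, E) (fun b ↦ G (a, b)) b
      ((mfderiv (𝓘(ℝ, E₁).prod 𝓘(ℝ, E₂)) 𝓘(ℝ, E) G (a, b)).comp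
        (ContinuousLinearMap.inr ℝ (TangentSpace 𝓘(ℝ, E₁) a) (TangentSpace 𝓘(ℝ, E₂) b))) :=
    (hG (a, b)).hasMFDerivAt.comp b ((hasMFDerivAt_const a b).prodMk (hasMFDerivAt_id b))
  have hxi' (a : N₁) (b : N₂) : ∃ w : TangentSpace 𝓘(ℝ, E₂) b,
      mfderiv (𝓘(ℝ, E₁).prod 𝓘(ℝ, E₂)) 𝓘(ℝ, E) G (a, b) ((0 : TangentSpace 𝓘(ℝ, E₁) a), w) =
        S.xi (G (a, b)) := by
    obtain ⟨w, hw⟩ := hxi a b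
    rw [(hright a b).mfderiv] at hw
    exact ⟨w, hw⟩
  obtain ⟨b₀⟩ := ‹Nonempty N₂›
  have hloc : IsLocallyConstant φ := by
    refine (IsLocallyConstant.iff_eventually_eq φ).2 fun a₀ ↦ ?_
    obtain ⟨u, hu⟩ := hS.exists_local_potential (G (a₀, b₀))
    -- A product neighbourhood of `(a₀, b₀)` on which `u ∘ G` has differential `η ∘ dG`. The set `t`
    -- chosen next must serve every `b` in `pb` at once.
    obtain ⟨pa, hpa, pb, hpb, hp⟩ := eventually_prod_iff.1 (nhds_prod_eq (x := a₀) (y := b₀) ▸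
      (hG (a₀, b₀)).continuousAt.eventually hu)
    obtain ⟨t, ht, hconst⟩ := exists_nhds_forall_eq_of_hasMFDerivAt_zero (F := E₁) hpa
    filter_upwards [ht, hpa] with a hat hpaa
    have hder (a : N₁) (ha : pa a) : HasMFDerivAt 𝓘(ℝ, E₂) 𝓘(ℝ, ℝ) (fun b ↦ u (G (a, b))) b₀ _ :=
      (hp ha hpb.self_of_nhds).comp b₀ (hright a b₀)
    -- Along the base `u ∘ G` has derivative `g(ξ, dG(v, 0))`, which vanishes because `ξ = dG(0, w)`
    -- and the warped metric makes the factors orthogonal.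
    have heq : (fun b ↦ u (G (a, b))) =ᶠ[𝓝 b₀] fun b ↦ u (G (a₀, b)) := by
      filter_upwards [hpb] with b hb
      refine hconst (fun a ↦ u (G (a, b))) (fun a ha ↦ ?_) a hat
      refine ((hp ha hb).comp a (hleft a b)).congr_mfderiv ?_
      ext v
      obtain ⟨w, hw⟩ := hxi' a b
      change inner ℝ (S.xi (G (a, b))) (mfderiv (𝓘(ℝ, E₁).prod 𝓘(ℝ, E₂)) 𝓘(ℝ, E) G (a, b)
        (v, (0 : TangentSpace 𝓘(ℝ, E₂) b))) = 0
      rw [← hw, hmetric']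
      simp
    -- Equal germs at `b₀` have equal differentials: the forms induced by `η` on the fibres over
    -- `a₀` and `a` coincide there.
    have hD := hasMFDerivAt_unique ((hder a₀ hpa.self_of_nhds).congr_of_eventuallyEq heq)
      (hder a hpaa)
    obtain ⟨w, hw⟩ := hxi' a b₀
    obtain ⟨w₀, hw₀⟩ := hxi' a₀ b₀
    have key (v : TangentSpace 𝓘(ℝ, E₂) b₀) :
        φ a₀ ^ 2 * (inner ℝ w₀ v : ℝ) = φ a ^ 2 * inner ℝ w v := by
      have h : (inner ℝ (S.xi (G (a₀, b₀))) (mfderiv (𝓘(ℝ, E₁).prod 𝓘(ℝ, E₂)) 𝓘(ℝ, E) G (a₀, b₀)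
          ((0 : TangentSpace 𝓘(ℝ, E₁) a₀), v)) : ℝ) = inner ℝ (S.xi (G (a, b₀)))
          (mfderiv (𝓘(ℝ, E₁).prod 𝓘(ℝ, E₂)) 𝓘(ℝ, E) G (a, b₀)
          ((0 : TangentSpace 𝓘(ℝ, E₁) a), v)) := congr($hD v)
      rw [← hw, ← hw₀, hmetric', hmetric'] at h
      simpa using h
    have h1 : φ a ^ 2 * (inner ℝ w w : ℝ) = 1 := by
      have h := S.inner_xi_xi (G (a, b₀))
      rw [← hw, hmetric'] at h
      simpa using h
    have h0 : φ a₀ ^ 2 * (inner ℝ w₀ w₀ : ℝ) = 1 := by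
      have h := S.inner_xi_xi (G (a₀, b₀))
      rw [← hw₀, hmetric'] at h
      simpa using h
    -- Testing `key` on `w` and on `w₀` gives `φ(a₀)² g₂(w₀, w) = 1 = φ(a)² g₂(w₀, w)`, so the
    -- common factor is nonzero and cancels.
    have k1 := (key w).trans h1
    have k0 := (key w₀).symm.trans h0
    rw [real_inner_comm] at k0
    have hne : (inner ℝ w₀ w : ℝ) ≠ 0 := by
      rintro h
      simp [h] at k1
    have hsq : φ a ^ 2 = φ a₀ ^ 2 := mul_right_cancel₀ hne (k0.trans k1.symm)
    exact (pow_left_inj₀ (hφ a).le (hφ a₀).le two_ne_zero).1 hsq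
  obtain ⟨a₀⟩ := (inferInstance : Nonempty N₁)
  exact ⟨φ a₀, fun a ↦ hloc.apply_eq_of_preconnectedSpace a a₀⟩

end WarpingFunction

/-! ### Pulling back and regrouping bi-warped product metrics. -/

section BiWarped

variable {E : Type*} [NormedAddCommGroup E] [NormedSpace ℝ E]
  {M : Type*} [TopologicalSpace M] [ChartedSpace E M]
  [RiemannianBundle (fun x : M ↦ TangentSpace 𝓘(ℝ, E) x)]
  {E₁ : Type*} [NormedAddCommGroup E₁] [NormedSpace ℝ E₁]
  {N₁ : Type*} [TopologicalSpace N₁] [ChartedSpace E₁ N₁]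
  [RiemannianBundle (fun x : N₁ ↦ TangentSpace 𝓘(ℝ, E₁) x)]
  {E₂ : Type*} [NormedAddCommGroup E₂] [NormedSpace ℝ E₂]
  {N₂ : Type*} [TopologicalSpace N₂] [ChartedSpace E₂ N₂]
  [RiemannianBundle (fun x : N₂ ↦ TangentSpace 𝓘(ℝ, E₂) x)]
  {E₃ : Type*} [NormedAddCommGroup E₃] [NormedSpace ℝ E₃]
  {N₃ : Type*} [TopologicalSpace N₃] [ChartedSpace E₃ N₃]
  [RiemannianBundle (fun x : N₃ ↦ TangentSpace 𝓘(ℝ, E₃) x)]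
  {φ₂ φ₃ : N₁ → ℝ} {f : N₁ × N₂ × N₃ → M}

/-- The metric induced by the composition of a bi-warped product submanifold with a smooth map. -/
lemma IsBiWarpedProductSubmanifold.inner_mfderiv_comp
    (hf : IsBiWarpedProductSubmanifold E E₁ E₂ E₃ φ₂ φ₃ f)
    {F : Type*} [NormedAddCommGroup F] [NormedSpace ℝ F] {H : Type*} [TopologicalSpace H]
    {I : ModelWithCorners ℝ F H} {P : Type*} [TopologicalSpace P] [ChartedSpace H P]
    {r₁ : P → N₁} {r₂ : P → N₂} {r₃ : P → N₃} {p : P}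
    (hr₁ : MDifferentiableAt I 𝓘(ℝ, E₁) r₁ p) (hr₂ : MDifferentiableAt I 𝓘(ℝ, E₂) r₂ p)
    (hr₃ : MDifferentiableAt I 𝓘(ℝ, E₃) r₃ p) (v w : TangentSpace I p) :
    (inner ℝ (mfderiv I 𝓘(ℝ, E) (fun q ↦ f (r₁ q, r₂ q, r₃ q)) p v)
      (mfderiv I 𝓘(ℝ, E) (fun q ↦ f (r₁ q, r₂ q, r₃ q)) p w) : ℝ) =
    inner ℝ (mfderiv I 𝓘(ℝ, E₁) r₁ p v) (mfderiv I 𝓘(ℝ, E₁) r₁ p w) +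
    φ₂ (r₁ p) ^ 2 * inner ℝ (mfderiv I 𝓘(ℝ, E₂) r₂ p v) (mfderiv I 𝓘(ℝ, E₂) r₂ p w) +
    φ₃ (r₁ p) ^ 2 * inner ℝ (mfderiv I 𝓘(ℝ, E₃) r₃ p v) (mfderiv I 𝓘(ℝ, E₃) r₃ p w) := by
  set J := 𝓘(ℝ, E₁).prod (𝓘(ℝ, E₂).prod 𝓘(ℝ, E₃))
  have hr : MDifferentiableAt I J (fun q ↦ (r₁ q, r₂ q, r₃ q)) p :=
    hr₁.prodMk (hr₂.prodMk hr₃)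
  have hfd := hf.smooth.mdifferentiable (by simp) (r₁ p, r₂ p, r₃ p)
  have h0 (v : TangentSpace I p) := mfderiv_comp_apply (I := I) (I' := J) (I'' := 𝓘(ℝ, E)) p
    hfd hr v
  have h1 (v : TangentSpace I p) := mfderiv_comp_apply (I := I) (I' := J) (I'' := 𝓘(ℝ, E₁))
    (g := fun q : N₁ × N₂ × N₃ ↦ q.1) p mdifferentiableAt_fst hr v
  have h2 (v : TangentSpace I p) := mfderiv_comp_apply (I := I) (I' := J) (I'' := 𝓘(ℝ, E₂))
    (g := fun q : N₁ × N₂ × N₃ ↦ q.2.1) p (mdifferentiableAt_snd.fst) hr v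
  have h3 (v : TangentSpace I p) := mfderiv_comp_apply (I := I) (I' := J) (I'' := 𝓘(ℝ, E₃))
    (g := fun q : N₁ × N₂ × N₃ ↦ q.2.2) p (mdifferentiableAt_snd.snd) hr v
  have hm := hf.metric (r₁ p, r₂ p, r₃ p) (mfderiv I J (fun q ↦ (r₁ q, r₂ q, r₃ q)) p v)
    (mfderiv I J (fun q ↦ (r₁ q, r₂ q, r₃ q)) p w)
  erw [← h0, ← h0, ← h1, ← h1, ← h2, ← h2, ← h3, ← h3] at hm
  exact hm

/-- The product metric evaluated at the projections of two vectors tangent to a triple product. -/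
lemma productMetric_mfderiv_fst (c : ℝ) (p : (N₁ × N₂) × N₃)
    (v w : TangentSpace ((𝓘(ℝ, E₁).prod 𝓘(ℝ, E₂)).prod 𝓘(ℝ, E₃)) p) :
    productMetric E₁ E₂ c p.1
      (mfderiv ((𝓘(ℝ, E₁).prod 𝓘(ℝ, E₂)).prod 𝓘(ℝ, E₃)) (𝓘(ℝ, E₁).prod 𝓘(ℝ, E₂))
        (fun q : (N₁ × N₂) × N₃ ↦ q.1) p v)
      (mfderiv ((𝓘(ℝ, E₁).prod 𝓘(ℝ, E₂)).prod 𝓘(ℝ, E₃)) (𝓘(ℝ, E₁).prod 𝓘(ℝ, E₂))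
        (fun q : (N₁ × N₂) × N₃ ↦ q.1) p w) =
    inner ℝ
      (mfderiv ((𝓘(ℝ, E₁).prod 𝓘(ℝ, E₂)).prod 𝓘(ℝ, E₃)) 𝓘(ℝ, E₁)
        (fun q : (N₁ × N₂) × N₃ ↦ q.1.1) p v)
      (mfderiv ((𝓘(ℝ, E₁).prod 𝓘(ℝ, E₂)).prod 𝓘(ℝ, E₃)) 𝓘(ℝ, E₁)
        (fun q : (N₁ × N₂) × N₃ ↦ q.1.1) p w) +
    c ^ 2 * inner ℝ
      (mfderiv ((𝓘(ℝ, E₁).prod 𝓘(ℝ, E₂)).prod 𝓘(ℝ, E₃)) 𝓘(ℝ, E₂)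
        (fun q : (N₁ × N₂) × N₃ ↦ q.1.2) p v)
      (mfderiv ((𝓘(ℝ, E₁).prod 𝓘(ℝ, E₂)).prod 𝓘(ℝ, E₃)) 𝓘(ℝ, E₂)
        (fun q : (N₁ × N₂) × N₃ ↦ q.1.2) p w) := by
  set I := (𝓘(ℝ, E₁).prod 𝓘(ℝ, E₂)).prod 𝓘(ℝ, E₃)
  have h1 (v : TangentSpace I p) := mfderiv_comp_apply (I := I) (I' := 𝓘(ℝ, E₁).prod 𝓘(ℝ, E₂))
    (I'' := 𝓘(ℝ, E₁)) (f := fun q : (N₁ × N₂) × N₃ ↦ q.1) (g := fun q : N₁ × N₂ ↦ q.1) p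
    mdifferentiableAt_fst mdifferentiableAt_fst v
  have h2 (v : TangentSpace I p) := mfderiv_comp_apply (I := I) (I' := 𝓘(ℝ, E₁).prod 𝓘(ℝ, E₂))
    (I'' := 𝓘(ℝ, E₂)) (f := fun q : (N₁ × N₂) × N₃ ↦ q.1) (g := fun q : N₁ × N₂ ↦ q.2) p
    mdifferentiableAt_snd mdifferentiableAt_fst v
  rw [productMetric, ← h1, ← h1, ← h2, ← h2]
  rfl

end BiWarped

/-! ### The two cases, obtained from slices of the bi-warped product. -/

theorem theorem3p1
    -- the ambient manifold `M` with its almost contact metric structure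
    {E : Type*} [NormedAddCommGroup E] [NormedSpace ℝ E] [FiniteDimensional ℝ E]
    {M : Type*} [TopologicalSpace M] [T2Space M] [ChartedSpace E M] [IsManifold 𝓘(ℝ, E) ∞ M]
    [RiemannianBundle (fun x : M ↦ TangentSpace 𝓘(ℝ, E) x)]
    [IsContMDiffRiemannianBundle 𝓘(ℝ, E) ∞ E (fun x : M ↦ TangentSpace 𝓘(ℝ, E) x)]
    (S : AlmostContactMetricStructure E M) (hS : S.IsLocallyConformalAlmostCosymplectic)
    -- the Riemannian manifolds `L_ν`, `L_T`, `L_⊥`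
    {E₁ : Type*} [NormedAddCommGroup E₁] [NormedSpace ℝ E₁] [FiniteDimensional ℝ E₁]
    {Lν : Type*} [TopologicalSpace Lν] [T2Space Lν] [ConnectedSpace Lν]
    [ChartedSpace E₁ Lν] [IsManifold 𝓘(ℝ, E₁) ∞ Lν]
    [RiemannianBundle (fun x : Lν ↦ TangentSpace 𝓘(ℝ, E₁) x)]
    [IsContMDiffRiemannianBundle 𝓘(ℝ, E₁) ∞ E₁ (fun x : Lν ↦ TangentSpace 𝓘(ℝ, E₁) x)]
    {E₂ : Type*} [NormedAddCommGroup E₂] [NormedSpace ℝ E₂] [FiniteDimensional ℝ E₂]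
    {LT : Type*} [TopologicalSpace LT] [T2Space LT] [Nonempty LT]
    [ChartedSpace E₂ LT] [IsManifold 𝓘(ℝ, E₂) ∞ LT]
    [RiemannianBundle (fun x : LT ↦ TangentSpace 𝓘(ℝ, E₂) x)]
    [IsContMDiffRiemannianBundle 𝓘(ℝ, E₂) ∞ E₂ (fun x : LT ↦ TangentSpace 𝓘(ℝ, E₂) x)]
    {E₃ : Type*} [NormedAddCommGroup E₃] [NormedSpace ℝ E₃] [FiniteDimensional ℝ E₃]
    {Lp : Type*} [TopologicalSpace Lp] [T2Space Lp] [Nonempty Lp]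
    [ChartedSpace E₃ Lp] [IsManifold 𝓘(ℝ, E₃) ∞ Lp]
    [RiemannianBundle (fun x : Lp ↦ TangentSpace 𝓘(ℝ, E₃) x)]
    [IsContMDiffRiemannianBundle 𝓘(ℝ, E₃) ∞ E₃ (fun x : Lp ↦ TangentSpace 𝓘(ℝ, E₃) x)]
    -- the bi-warped product submanifold
    (φ₁ φ₂ : Lν → ℝ) (f : Lν × LT × Lp → M)
    (hf : IsBiWarpedProductSubmanifold E E₁ E₂ E₃ φ₁ φ₂ f)
    (ν : ℝ) (hν : ν ∈ Set.Ioo 0 (Real.pi / 2))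
    (hslant : ∀ b c, S.IsSlant E₁ ν (fun a : Lν ↦ f (a, b, c)))
    (hinv : ∀ a c, S.IsInvariant E₂ (fun b : LT ↦ f (a, b, c)))
    (hanti : ∀ a b, S.IsAntiInvariant E₃ (fun c : Lp ↦ f (a, b, c))) :
    -- if `ξ` is a section of the tangent distribution of `L_T`
    ((∀ a b c, S.xi (f (a, b, c)) ∈ tangentImage E E₂ (fun b : LT ↦ f (a, b, c)) b) →
      ∃ k : ℝ, (∀ a, φ₁ a = k) ∧
        IsWarpedProductSubmanifold E E₁ E₂ E₃ k (fun q : Lν × LT ↦ φ₂ q.1)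
          (fun q : (Lν × LT) × Lp ↦ f (q.1.1, q.1.2, q.2))) ∧
    -- if `ξ` is a section of the tangent distribution of `L_⊥`
    ((∀ a b c, S.xi (f (a, b, c)) ∈ tangentImage E E₃ (fun c : Lp ↦ f (a, b, c)) c) →
      ∃ k : ℝ, (∀ a, φ₂ a = k) ∧
        IsWarpedProductSubmanifold E E₁ E₃ E₂ k (fun q : Lν × Lp ↦ φ₁ q.1)
          (fun q : (Lν × Lp) × LT ↦ f (q.1.1, q.2, q.1.2))) := by
  constructor
  · intro hxi
    obtain ⟨c₀⟩ := ‹Nonempty Lp›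
    -- The slice over a fixed `c₀` is a warped product with warping function `φ₁`: the constant
    -- third coordinate kills the `φ₂` term.
    obtain ⟨k, hk⟩ := hS.exists_warping_eq_const hf.pos₂
      (G := fun q : Lν × LT ↦ f (q.1, q.2, c₀))
      ((hf.smooth.mdifferentiable (by simp)).comp
        (mdifferentiable_fst.prodMk (mdifferentiable_snd.prodMk mdifferentiable_const)))
      (fun p v w ↦ by
        rw [hf.inner_mfderiv_comp (r₃ := fun _ ↦ c₀) mdifferentiableAt_fst mdifferentiableAt_snd
          mdifferentiableAt_const, mfderiv_const]
        erw [inner_zero_left]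
        rw [mul_zero, add_zero])
      (fun a b ↦ hxi a b c₀)
    refine ⟨k, hk, ?_⟩
    obtain ⟨a₀⟩ := (inferInstance : Nonempty Lν)
    refine ⟨hk a₀ ▸ hf.pos₂ a₀, fun b ↦ hf.pos₃ _, hf.smooth₃.comp contMDiff_fst,
      hf.smooth.comp (contMDiff_fst.fst.prodMk (contMDiff_fst.snd.prodMk contMDiff_snd)),
      fun p v w ↦ ?_⟩
    rw [hf.inner_mfderiv_comp (r₁ := fun q : (Lν × LT) × Lp ↦ q.1.1) (r₂ := fun q ↦ q.1.2)
      (r₃ := fun q ↦ q.2) mdifferentiableAt_fst.fst mdifferentiableAt_fst.snd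
      mdifferentiableAt_snd, hk, productMetric_mfderiv_fst]
  · intro hxi
    obtain ⟨b₀⟩ := ‹Nonempty LT›
    obtain ⟨k, hk⟩ := hS.exists_warping_eq_const hf.pos₃
      (G := fun q : Lν × Lp ↦ f (q.1, b₀, q.2))
      ((hf.smooth.mdifferentiable (by simp)).comp
        (mdifferentiable_fst.prodMk (mdifferentiable_const.prodMk mdifferentiable_snd)))
      (fun p v w ↦ by
        rw [hf.inner_mfderiv_comp (r₂ := fun _ ↦ b₀) mdifferentiableAt_fst mdifferentiableAt_const
          mdifferentiableAt_snd, mfderiv_const]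
        erw [inner_zero_left]
        rw [mul_zero, add_zero])
      (fun a c ↦ hxi a b₀ c)
    refine ⟨k, hk, ?_⟩
    obtain ⟨a₀⟩ := (inferInstance : Nonempty Lν)
    refine ⟨hk a₀ ▸ hf.pos₃ a₀, fun b ↦ hf.pos₂ _, hf.smooth₂.comp contMDiff_fst,
      hf.smooth.comp (contMDiff_fst.fst.prodMk (contMDiff_snd.prodMk contMDiff_fst.snd)),
      fun p v w ↦ ?_⟩
    rw [hf.inner_mfderiv_comp (r₁ := fun q : (Lν × Lp) × LT ↦ q.1.1) (r₂ := fun q ↦ q.2)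
      (r₃ := fun q ↦ q.1.2) mdifferentiableAt_fst.fst mdifferentiableAt_snd
      mdifferentiableAt_fst.snd, hk, productMetric_mfderiv_fst]
    -- The base now combines the first and third factors, so the last two summands trade places.
    exact add_right_comm _ _ _
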